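/- Simplicial complexes are finite and abstract, and the empty set is a face of every complex; a face $\sigma$ has dimension $\#\sigma-1$, and $\tilde H$ denotes reduced simplicial homology. For a finite set $\alpha$, let $\overline{\alpha}$ be the complex of all subsets of $\alpha$ and $\partial\alpha$ the complex of all proper subsets of $\alpha$. A *standard $e$-sphere* is a complex $\partial\alpha$ with $\#\alpha=e+2$. For a field $\mathbb F$, an *$\mathbb F$-homology $d$-sphere* is a complex in which the link of every face $\sigma$ (including $\sigma=\emptyset$) has the reduced $\mathbb F$-homology of a sphere of dimension $d-\#\sigma$. The boundary $\partial B$ of an $n$-dimensional complex $B$ is the subcomplex generated by its $(n-1)$-faces that lie in exactly one $n$-face. An *$\mathbb F$-homology $n$-ball* is a complex $B$ such that $\partial B$ is an $\mathbb F$-homology $(n-1)$-sphere, the link of every face $\sigma\notin\partial B$ has the reduced $\mathbb F$-homology of a sphere of dimension $n-\#\sigma$, and the link of every face $\sigma\in\partial B$ (including $\sigma=\emptyset$) has vanishing reduced $\mathbb F$-homology. A *homology sphere* (*ball*) is an $\mathbb F$-homology sphere (ball) for some field $\mathbb F$. A homology $(d+1)$-ball $B$ is *$k$-stacked* if all its faces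 of dimension at most $d-k$ lie in $\partial B$; a homology $d$-sphere is *$k$-stacked* if it is the boundary of a $k$-stacked homology $(d+1)$-ball. A subcomplex $Y$ of $X$ is *induced* if every face of $X$ contained in the vertex set of $Y$ is a face of $Y$; $X[U]$ denotes the subcomplex of all faces of $X$ contained in $U$. A $d$-dimensional complex $X$ *admits a bistellar move of index $i$* if there are disjoint non-empty finite sets $\alpha,\beta$ with $\dim\alpha+\dim\beta=d$ and $\dim\beta=i$ such that $X[\alpha\cup\beta]=\overline{\alpha}*\partial\beta$ (simplicial join). A *missing face of dimension $t$* of $X$ is a set of $t+1$ vertices of $X$ that is not a face of $X$ although all its proper subsets are. Let $k,d\ge 0$ be integers and let $S$ be a $k$-stacked homology $d$-sphere. 1. For $k\le e\le d-k-1$, no induced subcomplex of $S$ is a standard $e$-sphere. 2. For $k+1\le i\le d-k$, $S$ admits no bistellar move of index $i$. 3. Every missing face of $S$ has dimension $t\le k$ or $t\ge d-k+1$. -/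

import Mathlib

universe v w

set_option maxSynthPendingDepth 3

namespace PreAbstractSimplicialComplex

variable {V : Type v}

/-! ### Combinatorics of simplicial complexes

`PreAbstractSimplicialComplex V` lists the nonempty faces of a simplicial complex whose vertices
lie in `V`; elements of `V` need not be vertices. The empty set is, by convention, a face of every
simplicial complex. A face `σ` has dimension `σ.card - 1`. -/

/-- `σ` is a (possibly empty) face of `X`. -/
def IsFace (X : PreAbstractSimplicialComplex V) (σ : Finset V) : Prop :=
  σ = ∅ ∨ σ ∈ X

theorem IsFace.mono {X : PreAbstractSimplicialComplex V} {σ τ : Finset V}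
    (h : X.IsFace σ) (hτ : τ ⊆ σ) : X.IsFace τ := by
  rcases h with rfl | h
  · exact Or.inl (Finset.subset_empty.mp hτ)
  · rcases τ.eq_empty_or_nonempty with h0 | h0
    · exact Or.inl h0
    · exact Or.inr ((X.isRelLowerSet_faces h).2 hτ h0)

/-- The complex whose faces are the members of a family closed under taking subsets. -/
def ofFamily (P : Finset V → Prop) (hP : ∀ σ τ : Finset V, P σ → τ ⊆ σ → P τ) :
    PreAbstractSimplicialComplex V where
  faces := {σ | σ.Nonempty ∧ P σ}
  isRelLowerSet_faces := fun σ h => ⟨h.1, fun τ hτ h0 => ⟨h0, hP σ τ h.2 hτ⟩⟩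

/-- The vertex set of `X`. -/
def vertexSet (X : PreAbstractSimplicialComplex V) : Set V :=
  {x | {x} ∈ X}

/-- The complex of all subsets of `α` (the standard ball on the vertex set `α`). -/
def simplex (α : Finset V) : PreAbstractSimplicialComplex V :=
  ofFamily (fun σ => σ ⊆ α) (fun _ _ h hτ => hτ.trans h)

/-- The complex `∂α` of all proper subsets of `α`. -/
def simplexBoundary (α : Finset V) : PreAbstractSimplicialComplex V :=
  ofFamily (fun σ => σ ⊂ α) (fun _ _ h hτ => lt_of_le_of_lt hτ h)

/-- The join `X * Y`: its faces are the disjoint unions of a face of `X` and a face of `Y`. -/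
def join (X Y : PreAbstractSimplicialComplex V) : PreAbstractSimplicialComplex V :=
  ofFamily
    (fun σ => ∃ (a b : Finset V) (h : Disjoint a b),
      X.IsFace a ∧ Y.IsFace b ∧ σ = a.disjUnion b h)
    (by
      classical
      rintro σ τ ⟨a, b, h, ha, hb, rfl⟩ hτ
      refine ⟨τ ∩ a, τ ∩ b, h.mono Finset.inter_subset_right Finset.inter_subset_right,
        ha.mono Finset.inter_subset_right, hb.mono Finset.inter_subset_right, ?_⟩
      ext x
      have hx := @hτ x
      simp only [Finset.mem_disjUnion, Finset.mem_inter] at hx ⊢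
      tauto)

/-- The link of `σ` in `X`: the faces disjoint from `σ` whose union with `σ` is a face.
The link of the empty face is `X` itself. -/
def link (X : PreAbstractSimplicialComplex V) (σ : Finset V) : PreAbstractSimplicialComplex V :=
  ofFamily (fun τ => ∃ h : Disjoint σ τ, X.IsFace (σ.disjUnion τ h))
    (by
      rintro τ ρ ⟨h, hX⟩ hρ
      refine ⟨h.mono_right hρ, hX.mono ?_⟩
      intro x hx
      simp only [Finset.mem_disjUnion] at hx ⊢
      exact hx.imp_right (@hρ x))

/-- The subcomplex `X[U]` of all faces of `X` contained in `U`. -/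
def induced (X : PreAbstractSimplicialComplex V) (U : Set V) : PreAbstractSimplicialComplex V :=
  ofFamily (fun σ => X.IsFace σ ∧ (σ : Set V) ⊆ U)
    (fun _ _ h hτ => ⟨h.1.mono hτ, (Finset.coe_subset.mpr hτ).trans h.2⟩)

/-- `Y` is an induced subcomplex of `X`: it is a subcomplex, and every face of `X` contained in
the vertex set of `Y` is a face of `Y`. -/
def IsInducedSubcomplex (Y X : PreAbstractSimplicialComplex V) : Prop :=
  Y ≤ X ∧ ∀ σ, X.IsFace σ → (σ : Set V) ⊆ Y.vertexSet → Y.IsFace σ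

/-- `Y` is a standard `e`-sphere: the boundary complex of an `(e + 1)`-dimensional simplex. -/
def IsStandardSphere (e : ℕ) (Y : PreAbstractSimplicialComplex V) : Prop :=
  ∃ α : Finset V, α.card = e + 2 ∧ Y = simplexBoundary α

/-- `α` is a missing face of `X` of dimension `t`: it consists of `t + 1` vertices of `X`, it is
not a face, but all its proper subsets are faces. -/
def IsMissingFace (X : PreAbstractSimplicialComplex V) (t : ℕ) (α : Finset V) : Prop :=
  α.card = t + 1 ∧ (α : Set V) ⊆ X.vertexSet ∧ ¬ X.IsFace α ∧ ∀ τ, τ ⊂ α → X.IsFace τ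

/-- The `d`-dimensional complex `X` admits a bistellar move `α ↦ β` of index `i = dim β`: there are
disjoint nonempty sets `α` and `β` with `dim α + dim β = d` such that the induced subcomplex of `X`
on `α ∪ β` is the join of `simplex α` and `∂β`. (The move replaces it by the join of `∂α` and
`simplex β`.) -/
def AdmitsBistellarMove (d i : ℕ) (X : PreAbstractSimplicialComplex V) : Prop :=
  ∃ α β : Finset V, α.Nonempty ∧ β.Nonempty ∧ Disjoint α β ∧
    α.card + β.card = d + 2 ∧ β.card = i + 1 ∧
    X.induced ((α : Set V) ∪ (β : Set V)) = join (simplex α) (simplexBoundary β)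

/-- The boundary of an `n`-dimensional weak pseudomanifold `X`: the subcomplex generated by the
`(n - 1)`-dimensional faces that are contained in exactly one `n`-dimensional face. -/
def boundary (n : ℕ) (X : PreAbstractSimplicialComplex V) : PreAbstractSimplicialComplex V :=
  ofFamily
    (fun σ => ∃ τ, X.IsFace τ ∧ σ ⊆ τ ∧ τ.card = n ∧
      ∃! ρ : Finset V, X.IsFace ρ ∧ ρ.card = n + 1 ∧ τ ⊆ ρ)
    (fun _ _ ⟨τ, h, hσ, h'⟩ hτ => ⟨τ, h, hτ.trans hσ, h'⟩)

/-! ### Reduced simplicial homology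

Simplices are oriented by a linear order on `V`. Chains are graded by the number of vertices, so
that index `n` is homological degree `n - 1`; the empty face spans the chains of degree `-1`. -/

section Homology

variable (F : Type w) [Field F] [LinearOrder V]

/-- The simplicial boundary operator
`[x₀ < ⋯ < xₘ] ↦ ∑ j, (-1) ^ j [x₀, …, x̂ⱼ, …, xₘ]`, which sends `[∅]` to `0`. -/
noncomputable def chainBoundary : (Finset V →₀ F) →ₗ[F] (Finset V →₀ F) :=
  Finsupp.linearCombination F (fun σ : Finset V =>
    ∑ x ∈ σ, Finsupp.single (σ.erase x) ((-1 : F) ^ (σ.filter (fun y => y < x)).card))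

/-- The chains of `X` spanned by the faces with `n` elements. -/
def chains (X : PreAbstractSimplicialComplex V) (n : ℕ) : Submodule F (Finset V →₀ F) :=
  Finsupp.supported F F {σ | X.IsFace σ ∧ σ.card = n}

/-- The cycles among the chains spanned by the faces with `n` elements. -/
noncomputable def cycles (X : PreAbstractSimplicialComplex V) (n : ℕ) :
    Submodule F (Finset V →₀ F) :=
  chains F X n ⊓ LinearMap.ker (chainBoundary F)

/-- The boundaries of the chains spanned by the faces with `n + 1` elements. -/
noncomputable def boundaries (X : PreAbstractSimplicialComplex V) (n : ℕ) :
    Submodule F (Finset V →₀ F) :=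
  (chains F X (n + 1)).map (chainBoundary F)

/-- The reduced simplicial homology of `X` in degree `n - 1` with coefficients in `F`. -/
abbrev reducedHomology (X : PreAbstractSimplicialComplex V) (n : ℕ) : Type (max v w) :=
  cycles F X n ⧸ (boundaries F X n).submoduleOf (cycles F X n)

/-- All reduced homology of `X` vanishes. -/
def IsAcyclic (X : PreAbstractSimplicialComplex V) : Prop :=
  ∀ n : ℕ, Subsingleton (reducedHomology F X n)

/-- `X` has the reduced homology of an `m`-dimensional sphere (`m ≥ -1`; the sphere of
dimension `-1` is empty). -/
def HasSphereHomology (m : ℤ) (X : PreAbstractSimplicialComplex V) : Prop :=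
  -1 ≤ m ∧ ∀ n : ℕ,
    ((n : ℤ) - 1 = m → Module.finrank F (reducedHomology F X n) = 1) ∧
    ((n : ℤ) - 1 ≠ m → Subsingleton (reducedHomology F X n))

/-- `X` is an `F`-homology sphere of dimension `d`: a finite complex such that the link of every
face `σ`, the empty face included, has the homology of a sphere of dimension
`d - σ.card = d - 1 - dim σ`. (Such an `X` is pure of dimension `d`: the link of a facet has no
vertices, so it has the homology of a sphere of dimension `-1`.) -/
def IsHomologySphereOver (d : ℤ) (X : PreAbstractSimplicialComplex V) : Prop :=
  (X : Set (Finset V)).Finite ∧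
    ∀ σ, X.IsFace σ → HasSphereHomology F (d - σ.card) (X.link σ)

/-- `X` is an `F`-homology ball of dimension `n`: a finite complex such that the links of the faces
not in the boundary have the homology of spheres, the links of the faces in the boundary (`X`
itself, the link of the empty face, included) are acyclic, and the boundary is an `F`-homology
sphere of dimension `n - 1`. (Such an `X` is a pure weak pseudomanifold of dimension `n`, for the
same reason as above.) -/
def IsHomologyBallOver (n : ℕ) (X : PreAbstractSimplicialComplex V) : Prop :=
  (X : Set (Finset V)).Finite ∧
    (∀ σ, X.IsFace σ → ¬ (X.boundary n).IsFace σ →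
      HasSphereHomology F ((n : ℤ) - σ.card) (X.link σ)) ∧
    (∀ σ, (X.boundary n).IsFace σ → IsAcyclic F (X.link σ)) ∧
    IsHomologySphereOver F ((n : ℤ) - 1) (X.boundary n)

end Homology

/-- `X` is a homology sphere of dimension `d`: an `F`-homology sphere for some field `F`.
(Homology does not depend on the order that is used to orient the simplices.) -/
def IsHomologySphere (d : ℕ) (X : PreAbstractSimplicialComplex V) : Prop :=
  ∃ (F : Type w) (_ : Field F) (_ : LinearOrder V), IsHomologySphereOver F d X

/-- `X` is a homology ball of dimension `n`: an `F`-homology ball for some field `F`. -/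
def IsHomologyBall (n : ℕ) (X : PreAbstractSimplicialComplex V) : Prop :=
  ∃ (F : Type w) (_ : Field F) (_ : LinearOrder V), IsHomologyBallOver F n X

/-- `B` is a `k`-stacked homology `n`-ball: a homology `n`-ball all of whose faces of codimension at
least `k + 1` (dimension at most `n - k - 1`, so at most `n - k` vertices) lie in its boundary. -/
def IsStackedBall (k n : ℕ) (B : PreAbstractSimplicialComplex V) : Prop :=
  IsHomologyBall.{v, w} n B ∧
    ∀ σ, B.IsFace σ → (σ.card : ℤ) ≤ n - k → (B.boundary n).IsFace σ

/-- `S` is a `k`-stacked homology `d`-sphere: a homology `d`-sphere that is the boundary of a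
`k`-stacked homology `(d + 1)`-ball. -/
def IsStackedSphere (k d : ℕ) (S : PreAbstractSimplicialComplex V) : Prop :=
  IsHomologySphere.{v, w} d S ∧
    ∃ B : PreAbstractSimplicialComplex V, IsStackedBall.{v, w} k (d + 1) B ∧ B.boundary (d + 1) = S

end PreAbstractSimplicialComplex

namespace PreAbstractSimplicialComplex

/-! ### Faces of the basic constructions -/

section Faces

variable {V : Type v} {X : PreAbstractSimplicialComplex V}

/-! Everything reduces to missing faces of a `k`-stacked ball `B`. For `t > k` no link in `B` has
homology in degree `t - 1`: links of boundary faces are acyclic, and an interior face has so many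
vertices that its link is a homology sphere of dimension below `k`. By Mayer–Vietoris, deleting
vertices creates no homology in that degree (`cycles_induced_compl_le_boundaries`). Yet a missing
face `α` of dimension `t` would give the induced subcomplex `∂α`, a `(t - 1)`-sphere. Hence `t ≤ k`.

For `S = ∂B`, stackedness puts every small enough face of `B` in `S`, so a missing face of `S` of
dimension at most `d - k` is also missing in `B`. An induced standard sphere or a bistellar move
exhibits a missing face of `S` of a forbidden dimension. -/

theorem isFace_ofFamily {P : Finset V → Prop} {hP : ∀ σ τ : Finset V, P σ → τ ⊆ σ → P τ}
    {σ : Finset V} : (ofFamily P hP).IsFace σ ↔ σ = ∅ ∨ P σ := by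
  constructor
  · rintro (h | h)
    · exact Or.inl h
    · exact Or.inr h.2
  · rintro (h | h)
    · exact Or.inl h
    · rcases σ.eq_empty_or_nonempty with h0 | h0
      · exact Or.inl h0
      · exact Or.inr ⟨h0, h⟩

theorem isFace_empty : X.IsFace ∅ := Or.inl rfl

theorem isFace_induced {U : Set V} {σ : Finset V} :
    (X.induced U).IsFace σ ↔ X.IsFace σ ∧ (σ : Set V) ⊆ U := by
  rw [induced, isFace_ofFamily]
  constructor
  · rintro (rfl | h)
    · exact ⟨isFace_empty, by simp⟩
    · exact h
  · exact Or.inr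

theorem isFace_simplex {α σ : Finset V} : (simplex α).IsFace σ ↔ σ ⊆ α := by
  rw [simplex, isFace_ofFamily]
  exact or_iff_right_of_imp (by rintro rfl; simp)

theorem isFace_simplexBoundary {α σ : Finset V} (hα : α.Nonempty) :
    (simplexBoundary α).IsFace σ ↔ σ ⊂ α := by
  rw [simplexBoundary, isFace_ofFamily]
  exact or_iff_right_of_imp (by rintro rfl; exact hα.empty_ssubset)

theorem isFace_link [DecidableEq V] {σ τ : Finset V} (hσ : X.IsFace σ) :
    (X.link σ).IsFace τ ↔ Disjoint σ τ ∧ X.IsFace (σ ∪ τ) := by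
  rw [link, isFace_ofFamily]
  constructor
  · rintro (rfl | ⟨h, h'⟩)
    · simpa using hσ
    · exact ⟨h, by rwa [Finset.disjUnion_eq_union] at h'⟩
  · rintro ⟨h, h'⟩
    exact Or.inr ⟨h, by rwa [Finset.disjUnion_eq_union]⟩

theorem IsFace.of_boundary {n : ℕ} {σ : Finset V} (h : (X.boundary n).IsFace σ) : X.IsFace σ := by
  rw [boundary, isFace_ofFamily] at h
  rcases h with rfl | ⟨τ, hτ, hσ, -⟩
  · exact isFace_empty
  · exact hτ.mono hσ

/-- The bound `1 ≤ t` makes singletons proper subsets of `α`, so that its elements are vertices. -/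
theorem isMissingFace_of_isFace_iff {t : ℕ} {α : Finset V} (ht : 1 ≤ t) (hα : α.card = t + 1)
    (h : ∀ σ, σ ⊆ α → (X.IsFace σ ↔ σ ⊂ α)) : IsMissingFace X t α := by
  refine ⟨hα, fun x hx => ?_, fun h' => ssubset_irrefl α ((h α subset_rfl).1 h'),
    fun τ hτ => (h τ hτ.subset).2 hτ⟩
  have hx' : ({x} : Finset V) ⊆ α := Finset.singleton_subset_iff.2 hx
  have hf : X.IsFace {x} := (h _ hx').2 <| Finset.ssubset_iff_subset_ne.2
    ⟨hx', fun he => by rw [← he, Finset.card_singleton] at hα; omega⟩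
  exact hf.resolve_left (Finset.singleton_ne_empty x)

theorem finite_vertexSet (h : (X : Set (Finset V)).Finite) : X.vertexSet.Finite :=
  h.preimage Finset.singleton_injective.injOn

theorem chains_mono {F : Type w} [Field F] {Y : PreAbstractSimplicialComplex V}
    (h : ∀ σ, X.IsFace σ → Y.IsFace σ) (n : ℕ) :
    chains F X n ≤ chains F Y n :=
  Finsupp.supported_mono fun σ hσ => ⟨h σ hσ.1, hσ.2⟩

end Faces

/-! ### Vanishing homology under vertex deletion -/

section Homology

variable {V : Type v} {F : Type w} [Field F] [LinearOrder V]
  {X Y : PreAbstractSimplicialComplex V}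

theorem chainBoundary_single (σ : Finset V) (a : F) :
    chainBoundary F (Finsupp.single σ a) = a • ∑ x ∈ σ, Finsupp.single (σ.erase x)
      ((-1 : F) ^ (σ.filter (fun y => y < x)).card) := by
  rw [chainBoundary, Finsupp.linearCombination_single]

theorem card_filter_lt_erase_of_lt {σ : Finset V} {x y : V} (hx : x ∈ σ) (hxy : x < y) :
    ((σ.erase x).filter (fun z => z < y)).card + 1 = (σ.filter (fun z => z < y)).card := by
  rw [Finset.filter_erase, Finset.card_erase_add_one (by simp [hx, hxy])]

theorem filter_lt_erase_of_lt {σ : Finset V} {x y : V} (hxy : x < y) :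
    (σ.erase y).filter (fun z => z < x) = σ.filter (fun z => z < x) := by
  rw [Finset.filter_erase, Finset.erase_eq_of_notMem (by simp [hxy.le])]

theorem chainBoundary_chainBoundary (c : Finset V →₀ F) :
    chainBoundary F (chainBoundary F c) = 0 := by
  have key : chainBoundary F ∘ₗ chainBoundary F = (0 : (Finset V →₀ F) →ₗ[F] (Finset V →₀ F)) := by
    refine Finsupp.lhom_ext fun σ a => ?_
    rw [LinearMap.comp_apply, chainBoundary_single, map_smul, map_sum, LinearMap.zero_apply]
    simp only [chainBoundary_single, Finset.smul_sum, Finsupp.smul_single, smul_eq_mul]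
    rw [Finset.sum_sigma']
    have lt_case : ∀ x ∈ σ, ∀ y ∈ σ, x < y →
        (-1 : F) ^ (σ.filter (fun z => z < x)).card *
            (-1) ^ ((σ.erase x).filter (fun z => z < y)).card +
          (-1) ^ (σ.filter (fun z => z < y)).card *
            (-1) ^ ((σ.erase y).filter (fun z => z < x)).card = 0 := by
      intro x hx y hy hxy
      rw [filter_lt_erase_of_lt hxy, ← card_filter_lt_erase_of_lt hx hxy]
      ring
    -- Removing `x` then `y` cancels removing `y` then `x`: only removal of the smaller vertex
    -- shifts the position of the other.
    refine Finset.sum_involution (fun p _ => ⟨p.2, p.1⟩) ?_ ?_ ?_ ?_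
    · rintro ⟨x, y⟩ hp
      simp only [Finset.mem_sigma, Finset.mem_erase] at hp
      dsimp only
      rw [Finset.erase_right_comm, ← Finsupp.single_add, ← mul_add, Finsupp.single_eq_zero]
      refine mul_eq_zero_of_right _ ?_
      rcases lt_or_gt_of_ne hp.2.1 with h | h
      · rw [add_comm]
        exact lt_case y hp.2.2 x hp.1 h
      · exact lt_case x hp.1 y hp.2.2 h
    · rintro ⟨x, y⟩ hp - he
      simp only [Finset.mem_sigma, Finset.mem_erase] at hp
      exact hp.2.1 (congrArg Sigma.fst he)
    · rintro ⟨x, y⟩ hp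
      simp only [Finset.mem_sigma, Finset.mem_erase] at hp ⊢
      exact ⟨hp.2.2, hp.2.1.symm, hp.1⟩
    · rintro ⟨x, y⟩ -
      rfl
  exact LinearMap.congr_fun key c

/-- Every face in the boundary of a chain arises from a face of that chain by removing a vertex. -/
theorem chainBoundary_mem_supported {s t : Set (Finset V)} {c : Finset V →₀ F}
    (hc : c ∈ Finsupp.supported F F s) (h : ∀ σ ∈ s, ∀ x ∈ σ, σ.erase x ∈ t) :
    chainBoundary F c ∈ Finsupp.supported F F t := by
  rw [chainBoundary, Finsupp.linearCombination_apply]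
  refine Submodule.sum_mem _ fun σ hσ => Submodule.smul_mem _ _ <|
    Submodule.sum_mem _ fun x hx => Finsupp.single_mem_supported F _ (h σ (hc hσ) x hx)

theorem subsingleton_reducedHomology_iff {n : ℕ} :
    Subsingleton (reducedHomology F X n) ↔ cycles F X n ≤ boundaries F X n := by
  rw [Submodule.Quotient.subsingleton_iff, Submodule.submoduleOf_eq_top]

/-- If a complex and the link of a vertex `v` have no homology in some degree, then neither has
the deletion of `v`. -/
theorem cycles_le_boundaries_of_delete {n : ℕ} {v : V} (hv : X.IsFace {v})
    (hXY : ∀ σ, Y.IsFace σ ↔ X.IsFace σ ∧ v ∉ σ) (hX : cycles F X n ≤ boundaries F X n)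
    (hL : cycles F (X.link {v}) n ≤ boundaries F (X.link {v}) n) :
    cycles F Y n ≤ boundaries F Y n := by
  rintro z ⟨hz, hz0⟩
  obtain ⟨c, hc, rfl⟩ := hX ⟨chains_mono (fun σ hσ => ((hXY σ).1 hσ).1) n hz, hz0⟩
  have hlink : ∀ σ, (X.link {v}).IsFace σ → Y.IsFace σ := fun σ hσ => by
    rw [isFace_link hv, Finset.disjoint_singleton_left] at hσ
    exact (hXY σ).2 ⟨hσ.2.mono Finset.subset_union_right, hσ.1⟩
  -- This is exactness of Mayer–Vietoris at chain level: `b` lives on the star of `v`, `a` on the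
  -- deletion. Since `∂b = z - ∂a` avoids `v`, it is a cycle of the link, and a chain `f` of the
  -- link bounding it can replace `b`.
  set a := c.filter (fun σ => v ∉ σ) with ha_def
  set b := c.filter (fun σ => ¬ v ∉ σ) with hb_def
  have hab : a + b = c := Finsupp.filter_add_filter_not c _
  have ha : a ∈ chains F Y (n + 1) := fun σ hσ => by
    rw [Finset.mem_coe, ha_def, Finsupp.support_filter, Finset.mem_filter] at hσ
    exact ⟨(hXY σ).2 ⟨(hc hσ.1).1, hσ.2⟩, (hc hσ.1).2⟩
  have hb : b ∈ Finsupp.supported F F {σ | X.IsFace σ ∧ σ.card = n + 1 ∧ v ∈ σ} := fun σ hσ => by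
    rw [Finset.mem_coe, hb_def, Finsupp.support_filter, Finset.mem_filter, not_not] at hσ
    exact ⟨(hc hσ.1).1, (hc hσ.1).2, hσ.2⟩
  have hDb : chainBoundary F b ∈ chains F (X.link {v}) n := by
    have h1 : chainBoundary F b ∈ Finsupp.supported F F
        {τ | X.IsFace (insert v τ) ∧ τ.card = n} := by
      refine chainBoundary_mem_supported hb fun σ hσ x hx => ⟨hσ.1.mono ?_, ?_⟩
      · exact Finset.insert_subset hσ.2.2 (Finset.erase_subset x σ)
      · rw [Finset.card_erase_of_mem hx, hσ.2.1, Nat.add_sub_cancel]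
    have h2 : chainBoundary F b ∈ Finsupp.supported F F {τ : Finset V | v ∉ τ} := by
      rw [← hab, map_add] at hz
      rw [← add_sub_cancel_left (chainBoundary F a) (chainBoundary F b)]
      refine Submodule.sub_mem _ (Finsupp.supported_mono ?_ hz) (chainBoundary_mem_supported ha ?_)
      · exact fun σ hσ => ((hXY σ).1 hσ.1).2
      · exact fun σ hσ x _ hm => ((hXY σ).1 hσ.1).2 (Finset.mem_of_mem_erase hm)
    intro τ hτ
    refine ⟨(isFace_link hv).2 ⟨Finset.disjoint_singleton_left.2 (h2 hτ), ?_⟩, (h1 hτ).2⟩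
    exact (h1 hτ).1
  obtain ⟨f, hf, hfb⟩ := hL ⟨hDb, chainBoundary_chainBoundary b⟩
  refine ⟨a + f, Submodule.add_mem _ ha (chains_mono hlink _ hf), ?_⟩
  rw [map_add, hfb, ← map_add, hab]

theorem cycles_congr (h : ∀ σ, X.IsFace σ ↔ Y.IsFace σ) (n : ℕ) :
    cycles F X n = cycles F Y n := by
  simp only [cycles, chains, h]

theorem boundaries_congr (h : ∀ σ, X.IsFace σ ↔ Y.IsFace σ) (n : ℕ) :
    boundaries F X n = boundaries F Y n := by
  simp only [boundaries, chains, h]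

/-- If no link in `X` has homology in some degree, then neither has the induced subcomplex obtained
by deleting finitely many vertices. -/
theorem cycles_induced_compl_le_boundaries {n : ℕ} (U : Finset V) :
    ∀ X : PreAbstractSimplicialComplex V,
      (∀ σ, X.IsFace σ → cycles F (X.link σ) n ≤ boundaries F (X.link σ) n) →
      cycles F (X.induced (U : Set V)ᶜ) n ≤ boundaries F (X.induced (U : Set V)ᶜ) n := by
  -- `X` stays general, because the induction hypothesis is needed for `X` and for the link of `v`,
  -- in the same degree.
  induction U using Finset.induction_on with
  | empty =>
    intro X h
    have hX : ∀ σ, (X.induced ((∅ : Finset V) : Set V)ᶜ).IsFace σ ↔ (X.link ∅).IsFace σ := by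
      simp [isFace_induced, isFace_link isFace_empty]
    rw [cycles_congr hX, boundaries_congr hX]
    exact h ∅ isFace_empty
  | insert v U hvU ih =>
    intro X h
    have hdel : ∀ σ, (X.induced ((insert v U : Finset V) : Set V)ᶜ).IsFace σ ↔
        (X.induced (U : Set V)ᶜ).IsFace σ ∧ v ∉ σ := fun σ => by
      simp only [isFace_induced, Set.subset_compl_iff_disjoint_right, Finset.disjoint_coe,
        Finset.disjoint_insert_right]
      tauto
    by_cases hv : X.IsFace {v}
    · have hv' : (X.induced (U : Set V)ᶜ).IsFace {v} := isFace_induced.2 ⟨hv, by simpa using hvU⟩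
      refine cycles_le_boundaries_of_delete hv' hdel (ih X h) ?_
      have hlink : ∀ σ, ((X.link {v}).induced (U : Set V)ᶜ).IsFace σ ↔
          ((X.induced (U : Set V)ᶜ).link {v}).IsFace σ := fun σ => by
        simp only [isFace_induced, isFace_link hv, isFace_link hv',
          Set.subset_compl_iff_disjoint_right, Finset.disjoint_coe, Finset.disjoint_union_left,
          Finset.disjoint_singleton_left]
        tauto
      rw [← cycles_congr hlink, ← boundaries_congr hlink]
      refine ih _ fun σ hσ => ?_
      have hσ' := (isFace_link hv).1 hσ
      -- Links in the link of `v` are links in `X`, so they inherit the hypothesis.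
      have hll : ∀ τ, ((X.link {v}).link σ).IsFace τ ↔ (X.link ({v} ∪ σ)).IsFace τ := fun τ => by
        rw [isFace_link hσ, isFace_link hv, isFace_link hσ'.2, Finset.disjoint_union_left,
          Finset.disjoint_union_right, Finset.union_assoc]
        tauto
      rw [cycles_congr hll, boundaries_congr hll]
      exact h _ hσ'.2
    · have hX : ∀ σ, (X.induced ((insert v U : Finset V) : Set V)ᶜ).IsFace σ ↔
          (X.induced (U : Set V)ᶜ).IsFace σ := fun σ =>
        (hdel σ).trans (and_iff_left_of_imp fun hσ hm =>
          hv ((isFace_induced.1 hσ).1.mono (Finset.singleton_subset_iff.2 hm)))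
      rw [cycles_congr hX, boundaries_congr hX]
      exact ih X h

/-- A missing face of dimension `n` carries a nonzero homology class of degree `n - 1`. -/
theorem not_cycles_le_boundaries_of_isMissingFace {n : ℕ} {α : Finset V}
    (hα : IsMissingFace X n α) (hX : ∀ σ, X.IsFace σ → σ ⊆ α) :
    ¬ cycles F X n ≤ boundaries F X n := by
  obtain ⟨hcard, -, hnot, hsub⟩ := hα
  intro h
  have hz : chainBoundary F (Finsupp.single α 1) ∈ cycles F X n := by
    refine ⟨chainBoundary_mem_supported (s := {α}) (Finsupp.single_mem_supported F _ rfl) ?_,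
      chainBoundary_chainBoundary _⟩
    rintro _ rfl x hx
    exact ⟨hsub _ (Finset.erase_ssubset hx), by
      rw [Finset.card_erase_of_mem hx, hcard, Nat.add_sub_cancel]⟩
  obtain ⟨c, hc, hcz⟩ := h hz
  -- The only candidate face with `n + 1` vertices is `α`, which is not a face.
  have hc0 : c = 0 := by
    rw [← Finsupp.support_eq_empty, Finset.eq_empty_iff_forall_notMem]
    intro σ hσ
    obtain ⟨hσX, hσc⟩ := hc hσ
    exact hnot (Finset.eq_of_subset_of_card_le (hX σ hσX) (by rw [hcard, hσc]) ▸ hσX)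
  rw [hc0, map_zero, chainBoundary_single, one_smul] at hcz
  obtain ⟨x, hx⟩ : α.Nonempty := Finset.card_pos.1 (by omega)
  have hcoeff := DFunLike.congr_fun hcz (α.erase x)
  rw [Finsupp.zero_apply, Finsupp.finsetSum_apply, Finset.sum_eq_single_of_mem x hx,
    Finsupp.single_eq_same] at hcoeff
  · exact pow_ne_zero _ (neg_ne_zero.2 one_ne_zero) hcoeff.symm
  · intro y hy hyx
    refine Finsupp.single_eq_of_ne fun he => hyx ?_
    exact (Finset.erase_inj _ hy).1 he.symm

/-- Deleting the finitely many vertices outside `α` would leave `∂α`, whose top homology is nonzero.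
-/
theorem not_isMissingFace_of_links {n : ℕ} (hfin : X.vertexSet.Finite)
    (h : ∀ σ, X.IsFace σ → cycles F (X.link σ) n ≤ boundaries F (X.link σ) n) (α : Finset V) :
    ¬ IsMissingFace X n α := by
  intro hα
  have hX : ∀ σ, (X.induced ((hfin.toFinset \ α : Finset V) : Set V)ᶜ).IsFace σ ↔
      X.IsFace σ ∧ σ ⊆ α := fun σ => by
    rw [isFace_induced]
    refine and_congr_right fun hσ => ⟨fun hs x hx => ?_, fun hs x hx => by simp [hs hx]⟩
    have hxv : x ∈ X.vertexSet :=
      (hσ.mono (Finset.singleton_subset_iff.2 hx)).resolve_left (Finset.singleton_ne_empty x)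
    by_contra hxα
    exact hs hx (by simp [hxv, hxα])
  refine not_cycles_le_boundaries_of_isMissingFace (F := F) (α := α) ?_
    (fun σ hσ => ((hX σ).1 hσ).2) (cycles_induced_compl_le_boundaries (hfin.toFinset \ α) X h)
  obtain ⟨hcard, hvert, hnot, hsub⟩ := hα
  refine ⟨hcard, fun x hx => ?_, fun hf => hnot ((hX α).1 hf).1,
    fun τ hτ => (hX τ).2 ⟨hsub τ hτ, hτ.subset⟩⟩
  exact ((hX {x}).2 ⟨Or.inr (hvert hx), Finset.singleton_subset_iff.2 hx⟩).resolve_left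
    (Finset.singleton_ne_empty x)

end Homology

/-! ### Missing faces of stacked balls and spheres -/

variable {V : Type v}

/-- All missing faces of a `k`-stacked homology ball have dimension at most `k`. -/
theorem IsStackedBall.le_of_isMissingFace {k n t : ℕ} {B : PreAbstractSimplicialComplex V}
    (hB : IsStackedBall.{v, w} k n B) {α : Finset V} (hα : IsMissingFace B t α) : t ≤ k := by
  obtain ⟨⟨F, _, _, hfin, hint, hbd, -⟩, hst⟩ := hB
  by_contra! hkt
  refine not_isMissingFace_of_links (F := F) (finite_vertexSet hfin) (fun σ hσ => ?_) α hα
  rw [← subsingleton_reducedHomology_iff]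
  by_cases hσb : (B.boundary n).IsFace σ
  · exact hbd σ hσb t
  · have hlt : (n : ℤ) - k < σ.card := by
      by_contra! hle
      exact hσb (hst σ hσ hle)
    -- Index `t` is degree `t - 1 ≥ k`, whereas the sphere dimension `n - σ.card` is less than `k`.
    exact ((hint σ hσ hσb).2 t).2 (by omega)

theorem IsStackedSphere.isMissingFace_dim {k d t : ℕ} {S : PreAbstractSimplicialComplex V}
    (hS : IsStackedSphere.{v, w} k d S) {α : Finset V} (hα : IsMissingFace S t α) :
    t ≤ k ∨ (d : ℤ) - k + 1 ≤ t := by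
  obtain ⟨-, B, hB, rfl⟩ := hS
  obtain ⟨hcard, hvert, hnot, hsub⟩ := hα
  by_contra! hlt
  refine absurd (hB.le_of_isMissingFace (t := t) (α := α) ⟨hcard, fun x hx => ?_, fun hf => ?_,
    fun τ hτ => (hsub τ hτ).of_boundary⟩) (by omega)
  · exact (IsFace.of_boundary (Or.inr (hvert hx))).resolve_left (Finset.singleton_ne_empty x)
  · exact hnot (hB.2 α hf (by push_cast [hcard]; omega))

end PreAbstractSimplicialComplex

open PreAbstractSimplicialComplex in
theorem corollary2 {V : Type v} (k d : ℕ) (S : PreAbstractSimplicialComplex V)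
    (hS : IsStackedSphere.{v, w} k d S) :
    (∀ e : ℕ, k ≤ e → (e : ℤ) ≤ d - k - 1 →
      ¬ ∃ Y : PreAbstractSimplicialComplex V, IsStandardSphere e Y ∧ IsInducedSubcomplex Y S) ∧
    (∀ i : ℕ, k + 1 ≤ i → (i : ℤ) ≤ d - k → ¬ AdmitsBistellarMove d i S) ∧
    (∀ (t : ℕ) (α : Finset V), IsMissingFace S t α → t ≤ k ∨ (d : ℤ) - k + 1 ≤ t) := by
  refine ⟨?_, ?_, fun t α hα => hS.isMissingFace_dim hα⟩
  · rintro e hke hed ⟨_, ⟨α, hα, rfl⟩, hle, hind⟩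
    have hne : α.Nonempty := Finset.card_pos.1 (by omega)
    -- As `α` has at least two elements, the vertex set of `∂α` is all of `α`; inducedness then
    -- keeps `α` itself out of `S`.
    have hm : IsMissingFace S (e + 1) α := by
      refine isMissingFace_of_isFace_iff (by omega) hα fun σ hσ => ⟨fun hf => ?_, fun hf => ?_⟩
      · refine (isFace_simplexBoundary hne).1 (hind σ hf fun x hx => ?_)
        refine ((isFace_simplexBoundary hne).2 ?_).resolve_left (Finset.singleton_ne_empty x)
        refine Finset.ssubset_iff_subset_ne.2 ⟨Finset.singleton_subset_iff.2 (hσ hx), fun he => ?_⟩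
        rw [← he, Finset.card_singleton] at hα
        omega
      · exact ((isFace_simplexBoundary hne).2 hf).imp_right (@hle σ)
    have := hS.isMissingFace_dim hm
    omega
  · rintro i hki hid ⟨α, β, -, hne, hdisj, -, hβ, hind⟩
    have hm : IsMissingFace S i β := by
      refine isMissingFace_of_isFace_iff (by omega) hβ fun σ hσ => ?_
      have h1 : S.IsFace σ ↔ (join (simplex α) (simplexBoundary β)).IsFace σ := by
        rw [← hind, isFace_induced, and_iff_left]
        exact (Finset.coe_subset.2 hσ).trans Set.subset_union_right
      rw [h1, join, isFace_ofFamily]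
      constructor
      · rintro (rfl | ⟨a, b, hab, ha, hb, rfl⟩)
        · exact hne.empty_ssubset
        · rw [isFace_simplex] at ha
          rw [isFace_simplexBoundary hne] at hb
          -- Within `β` the factor from `α` is empty, so the join restricts to `∂β`.
          have ha0 : a = ∅ := Finset.disjoint_self_iff_empty a |>.1 <|
            hdisj.mono ha fun x hx => hσ (by simp [hx])
          subst ha0
          simpa using hb
      · intro h
        exact Or.inr ⟨∅, σ, Finset.disjoint_empty_left σ, isFace_empty,
          (isFace_simplexBoundary hne).2 h, by simp⟩
    have := hS.isMissingFace_dim hm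
    omega
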